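/- Let $M^1(S^2)$ be the space of Borel probability measures on the unit sphere $S^2\subset\mathbb R^3$, with the weak topology, and identify $S^2$ with $\hat{\mathbb C}=\mathbb C\cup\{\infty\}$ by stereographic projection from the north pole, so that the antipode of $a$ is $-1/\bar a$ (with $0$ and $\infty$ interchanged). A point $w$ of the open unit ball is the conformal barycenter of $\mu\in M^1(S^2)$ if $\mu(\{z\})<1/2$ for every $z\in S^2$ and $$\int_{S^2} A_w(\zeta)\,d\mu(\zeta)=0,\qquad A_w(\zeta)=\frac{1-|w|^2}{|\zeta-w|^2}(\zeta-w)-w,$$ where $A_w$ is the boundary action of a Möbius automorphism of the ball that takes $w$ to $0$. The measure $\mu$ is barycentered if its conformal barycenter is the origin, that is, if it has no atom of mass $\ge 1/2$ and its Euclidean center of mass $\int_{S^2}\zeta\,d\mu(\zeta)$ is $0$. Let $BCM\subset M^1(S^2)$ be the set of barycentered measures and $\overline{BCM}$ its closure. The group $SO(3)$ acts by push-forward; give $BCM/SO(3)$ and $\overline{BCM}/SO(3)$ the quotient topologies. **Theorem.** $BCM/SO(3)$ is a locally compact Hausdorff space, and it is not compact. The quotient $\overline{BCM}/SO(3)$ is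 its one-point compactification: the map $BCM/SO(3)\to\overline{BCM}/SO(3)$ induced by the inclusion extends to a homeomorphism from the one-point compactification of $BCM/SO(3)$ onto $\overline{BCM}/SO(3)$. The added point is the class that consists exactly of the measures $\tfrac12\delta_a+\tfrac12\delta_{-1/\bar a}$, $a\in\hat{\mathbb C}$; in particular all of these lie in $\overline{BCM}$. -/

import Mathlib

open MeasureTheory

noncomputable section

namespace BaryMeasures

/-- Euclidean three-space. -/
abbrev E3 : Type := EuclideanSpace ℝ (Fin 3)

/-- The unit sphere `S²` in `ℝ³`, the boundary of the ball model of hyperbolic three-space. -/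
abbrev S2 : Type := Metric.sphere (0 : E3) 1

/-- The rotation group `SO(3)`. -/
abbrev SO3 : Type := Matrix.specialOrthogonalGroup (Fin 3) ℝ

/-- The space of Borel probability measures on the sphere; Mathlib's topology on it is the topology
of weak convergence, that is of convergence of integrals of continuous functions. -/
abbrev M1 : Type := ProbabilityMeasure S2

/-! ### The Riemann sphere and stereographic projection -/

/-- Identification of the Riemann sphere `ℂ ∪ {∞}` with `S²` by stereographic projection from the
north pole: `z ↦ (2 Re z, 2 Im z, |z|² - 1) / (|z|² + 1)` and `∞ ↦ (0, 0, 1)`. -/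
def stereo (a : OnePoint ℂ) : S2 :=
  a.elim
    ⟨!₂[0, 0, 1], by simp [EuclideanSpace.norm_eq, Fin.sum_univ_three]⟩
    (fun z =>
      ⟨!₂[2 * z.re / (Complex.normSq z + 1), 2 * z.im / (Complex.normSq z + 1),
          (Complex.normSq z - 1) / (Complex.normSq z + 1)], by
        have h : Complex.normSq z + 1 ≠ 0 := by
          have := Complex.normSq_nonneg z
          positivity
        have key : (2 * z.re / (Complex.normSq z + 1)) ^ 2
            + (2 * z.im / (Complex.normSq z + 1)) ^ 2
            + ((Complex.normSq z - 1) / (Complex.normSq z + 1)) ^ 2 = 1 := by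
          field_simp
          rw [Complex.normSq_apply]
          ring
        rw [mem_sphere_zero_iff_norm, EuclideanSpace.norm_eq, Real.sqrt_eq_one]
        simpa [Fin.sum_univ_three] using key⟩)

open Classical in
/-- The map `a ↦ -1 / conj a` of the Riemann sphere, which exchanges `0` and `∞`. -/
def antipode (a : OnePoint ℂ) : OnePoint ℂ :=
  a.elim ((0 : ℂ) : OnePoint ℂ)
    (fun z => if z = 0 then OnePoint.infty else ((-1 / (starRingEnd ℂ) z : ℂ) : OnePoint ℂ))

/-- The probability measure `½ δ_x + ½ δ_y`. -/
def halfHalf (x y : S2) : M1 :=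
  ⟨(1 / 2 : ENNReal) • Measure.dirac x + (1 / 2 : ENNReal) • Measure.dirac y,
    ⟨by simp [ENNReal.inv_two_add_inv_two]⟩⟩

/-! ### The action of `SO(3)` -/

theorem norm_toEuclideanLin (g : SO3) (x : E3) :
    ‖Matrix.toEuclideanLin (g : Matrix (Fin 3) (Fin 3) ℝ) x‖ = ‖x‖ := by
  have hg : (g : Matrix (Fin 3) (Fin 3) ℝ).transpose * (g : Matrix (Fin 3) (Fin 3) ℝ) = 1 :=
    (Matrix.mem_orthogonalGroup_iff' (Fin 3) ℝ).1
      (Matrix.mem_specialOrthogonalGroup_iff.1 g.2).1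
  have h : ‖Matrix.toEuclideanLin (g : Matrix (Fin 3) (Fin 3) ℝ) x‖ ^ 2 = ‖x‖ ^ 2 := by
    rw [EuclideanSpace.real_norm_sq_eq, EuclideanSpace.real_norm_sq_eq]
    have e : ∀ v : Fin 3 → ℝ, ∑ i, v i ^ 2 = v ⬝ᵥ v := fun v => by
      simp [dotProduct, sq]
    rw [e, e, Matrix.ofLp_toLpLin, Matrix.toLin'_apply, Matrix.dotProduct_mulVec,
      ← Matrix.mulVec_transpose, Matrix.mulVec_mulVec, hg, Matrix.one_mulVec]
  exact (sq_eq_sq₀ (norm_nonneg _) (norm_nonneg _)).1 h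

/-- The rotation action of `SO(3)` on the sphere, by matrix multiplication. -/
instance : MulAction SO3 S2 where
  smul g x := ⟨Matrix.toEuclideanLin (g : Matrix (Fin 3) (Fin 3) ℝ) (x : E3), by
    rw [mem_sphere_zero_iff_norm, norm_toEuclideanLin]
    exact mem_sphere_zero_iff_norm.1 x.2⟩
  one_smul x := Subtype.ext <| by
    change Matrix.toEuclideanLin (1 : Matrix (Fin 3) (Fin 3) ℝ) (x : E3) = x
    simp
  mul_smul g h x := Subtype.ext <| by
    change Matrix.toEuclideanLin ((g : Matrix (Fin 3) (Fin 3) ℝ) * (h : Matrix (Fin 3) (Fin 3) ℝ))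
        (x : E3) = Matrix.toEuclideanLin (g : Matrix (Fin 3) (Fin 3) ℝ)
          (Matrix.toEuclideanLin (h : Matrix (Fin 3) (Fin 3) ℝ) (x : E3))
    apply (WithLp.ofLp_injective 2)
    simp [Matrix.mulVec_mulVec]

theorem continuous_rotation (g : SO3) : Continuous fun x : S2 => g • x :=
  ((Matrix.toEuclideanLin (g : Matrix (Fin 3) (Fin 3) ℝ)).continuous_of_finiteDimensional.comp
    continuous_subtype_val).subtype_mk _

/-- The action of `SO(3)` on probability measures by push-forward, `g • μ = g_* μ`. -/
instance : MulAction SO3 M1 where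
  smul g μ := μ.map (continuous_rotation g).measurable.aemeasurable
  one_smul μ := Subtype.ext <| by
    change (μ : Measure S2).map (fun x => (1 : SO3) • x) = μ
    simp
  mul_smul g h μ := Subtype.ext <| by
    change (μ : Measure S2).map (fun x => (g * h) • x)
      = ((μ : Measure S2).map (fun x => h • x)).map (fun x => g • x)
    rw [Measure.map_map (continuous_rotation g).measurable (continuous_rotation h).measurable]
    congr 1
    funext x
    exact mul_smul g h x

/-- The equivalence relation on a set `X` of probability measures whose classes are the
intersections of `X` with the `SO(3)`-orbits (the orbits themselves when `X` is invariant). -/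
def rotationSetoid (X : Set M1) : Setoid X :=
  (MulAction.orbitRel SO3 M1).comap Subtype.val

/-- The quotient space `X / SO(3)`, with the quotient of the weak topology. -/
abbrev ModRotations (X : Set M1) : Type := Quotient (rotationSetoid X)

/-- The map `X / SO(3) → Y / SO(3)` induced by an inclusion `X ⊆ Y`. -/
def inclusionModRotations {X Y : Set M1} (h : X ⊆ Y) : ModRotations X → ModRotations Y :=
  Quotient.map (Set.inclusion h) (fun _ _ hab => hab)

/-! ### Barycentered measures -/

/-- The restriction to the sphere of the Möbius transformation
`x ↦ ((1 - |w|²) (x - w) - |x - w|² w) / (1 - 2 ⟨x, w⟩ + |x|² |w|²)` of the unit ball, a hyperbolic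
isometry that takes `w` to `0`. For `|x| = 1` the denominator is `|x - w|²`. -/
def moebiusToOrigin (w : E3) (x : S2) : E3 :=
  ((1 - ‖w‖ ^ 2) / ‖(x : E3) - w‖ ^ 2) • ((x : E3) - w) - w

/-- `w` is the conformal barycenter of `μ`: it lies in the open unit ball, `μ` has no atom of
mass `≥ 1/2`, and the image of `μ` under the Möbius transformation that takes `w` to the origin has
Euclidean center of mass `0`. -/
def IsConformalBarycenter (μ : M1) (w : E3) : Prop :=
  ‖w‖ < 1 ∧ (∀ z : S2, (μ : Measure S2) {z} < 1 / 2) ∧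
    ∫ x, moebiusToOrigin w x ∂(μ : Measure S2) = 0

/-- The set of barycentered measures: those whose conformal barycenter is the origin. -/
def BCM : Set M1 := {μ | IsConformalBarycenter μ 0}

end BaryMeasures

end

open BaryMeasures

namespace BaryMeasures

open Topology

/-! ### Topology of the rotation action -/

/-! The closure of `BCM` is the set `centered` of all measures with center of mass zero
(`closure_BCM`). That set is closed in the compact space `M1`, hence compact. A centered measure
with an atom of mass at least 1/2 at `z` must be the antipodal pair at `z` and `-z`
(`eq_halfHalf_of_half_le`), and mixing in a second antipodal pair with small weight shows that such
pairs are limits of barycentered measures.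

The pairs form one orbit, because rotations are transitive on axes (`exists_smul_halfHalf_eq`), and
this orbit is compact, so `BCM` is open in its closure. The group is compact and acts continuously,
so the quotient map is open and the quotients are Hausdorff. Therefore `BCM/SO(3)` embeds in the
compact Hausdorff space `closure BCM / SO(3)` as the open complement of a single point, which makes
the latter its one-point compactification. Density of `BCM` makes that point non-isolated, whence
noncompactness. -/

instance : CompactSpace SO3 := by
  suffices IsCompact (Matrix.specialOrthogonalGroup (Fin 3) ℝ : Set (Matrix (Fin 3) (Fin 3) ℝ))
    from isCompact_iff_compactSpace.1 this
  refine IsCompact.of_isClosed_subset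
    (isCompact_univ_pi fun _ : Fin 3 => isCompact_univ_pi fun _ : Fin 3 =>
      isCompact_Icc (a := (-1 : ℝ)) (b := 1)) ?_ ?_
  · have h : (Matrix.specialOrthogonalGroup (Fin 3) ℝ : Set (Matrix (Fin 3) (Fin 3) ℝ))
        = {A | A * A.transpose = 1} ∩ {A | A.det = 1} := by
      ext A
      exact Matrix.mem_specialOrthogonalGroup_iff.trans
        (and_congr (Matrix.mem_orthogonalGroup_iff (Fin 3) ℝ) Iff.rfl)
    have hc : Continuous fun A : Matrix (Fin 3) (Fin 3) ℝ => A := continuous_id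
    rw [h]
    exact (isClosed_eq (hc.matrix_mul hc.matrix_transpose) continuous_const).inter
      (isClosed_eq hc.matrix_det continuous_const)
  · intro A hA i _ j _
    have := entry_norm_bound_of_unitary (𝕜 := ℝ)
      (Matrix.mem_specialOrthogonalGroup_iff.1 hA).1 i j
    rwa [Real.norm_eq_abs, abs_le] at this

theorem coe_rotation (g : SO3) (x : S2) :
    ((g • x : S2) : E3) = Matrix.toEuclideanLin (g : Matrix (Fin 3) (Fin 3) ℝ) (x : E3) := rfl

theorem rotation_neg (g : SO3) (x : S2) : g • (-x) = -(g • x) :=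
  Subtype.ext <| by simp [coe_rotation]

instance : ContinuousSMul SO3 S2 where
  continuous_smul := by
    refine Continuous.subtype_mk ?_ _
    refine (PiLp.continuous_toLp 2 _).comp ?_
    refine Continuous.matrix_mulVec (A := fun p : SO3 × S2 => (p.1 : Matrix (Fin 3) (Fin 3) ℝ))
      (B := fun p : SO3 × S2 => WithLp.ofLp (p.2 : E3)) ?_ ?_
    · exact continuous_subtype_val.comp continuous_fst
    · exact (PiLp.continuous_ofLp 2 _).comp (continuous_subtype_val.comp continuous_snd)

theorem coe_rotation_measure (g : SO3) (μ : M1) :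
    ((g • μ : M1) : Measure S2) = (μ : Measure S2).map fun x => g • x := rfl

/-- Integration of a continuous function against a probability measure on a compact space is
jointly continuous. -/
theorem continuous_integral_prod {X : Type*} [TopologicalSpace X] [CompactSpace X]
    [MeasurableSpace X] [OpensMeasurableSpace X] :
    Continuous fun p : C(X, ℝ) × ProbabilityMeasure X => ∫ x, p.1 x ∂(p.2 : Measure X) := by
  rw [continuous_iff_continuousAt]
  rintro ⟨f, μ⟩
  have hint : ∀ (h : C(X, ℝ)) (ν : ProbabilityMeasure X), Integrable h (ν : Measure X) :=
    fun h ν => (BoundedContinuousFunction.mkOfCompact h).integrable (ν : Measure X)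
  have h2 : Filter.Tendsto (fun p : C(X, ℝ) × ProbabilityMeasure X =>
      ∫ x, f x ∂(p.2 : Measure X)) (𝓝 (f, μ)) (𝓝 (∫ x, f x ∂(μ : Measure X))) :=
    ((ProbabilityMeasure.continuous_integral_continuousMap f).comp continuous_snd).tendsto (f, μ)
  -- Split the integral of `p.1` into those of `f` and `p.1 - f`; the measures have mass one, so the
  -- latter is at most the sup norm of `p.1 - f`, uniformly in the measure.
  have h1 : Filter.Tendsto (fun p : C(X, ℝ) × ProbabilityMeasure X =>
      ∫ x, (p.1 - f) x ∂(p.2 : Measure X)) (𝓝 (f, μ)) (𝓝 0) := by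
    refine squeeze_zero_norm (a := fun p => ‖p.1 - f‖) (fun p => ?_) ?_
    · refine (norm_integral_le_of_norm_le_const (C := ‖p.1 - f‖)
        (Filter.Eventually.of_forall fun x => (p.1 - f).norm_coe_le_norm x)).trans ?_
      simp
    · have : Continuous fun p : C(X, ℝ) × ProbabilityMeasure X => ‖p.1 - f‖ := by fun_prop
      simpa using this.tendsto (f, μ)
  have := h1.add h2
  rw [zero_add] at this
  refine this.congr fun p => ?_
  rw [← integral_add (hint _ _) (hint _ _)]
  simp

/-- Against a test function `f`, moving `g` from the measure to the function gives the integral of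
`x ↦ f (g • x)`. By currying, this function depends continuously on `g` in sup norm, so joint
continuity of the pairing applies. -/
instance : ContinuousSMul SO3 M1 where
  continuous_smul := by
    rw [ProbabilityMeasure.continuous_iff_forall_continuousMap_continuous_integral]
    intro f
    let F : C(SO3, C(S2, ℝ)) :=
      ContinuousMap.curry ⟨fun p : SO3 × S2 => f (p.1 • p.2), by fun_prop⟩
    have h : Continuous fun p : SO3 × M1 => ∫ x, F p.1 x ∂(p.2 : Measure S2) :=
      continuous_integral_prod.comp ((F.continuous.comp continuous_fst).prodMk continuous_snd)
    refine h.congr fun p => ?_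
    rw [coe_rotation_measure, integral_map (continuous_rotation p.1).measurable.aemeasurable
      f.continuous.aestronglyMeasurable]
    rfl

/-! ### Quotients by rotations -/

theorem rotationSetoid_iff {X : Set M1} {a b : X} :
    rotationSetoid X a b ↔ ∃ g : SO3, g • (b : M1) = a := Iff.rfl

theorem mk_eq_mk_iff {X : Set M1} {a b : X} :
    (Quotient.mk (rotationSetoid X) a = Quotient.mk (rotationSetoid X) b)
      ↔ ∃ g : SO3, g • (b : M1) = a :=
  Quotient.eq.trans rotationSetoid_iff

/-- The saturation of an open set is the union of its preimages under the rotations. -/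
theorem isOpenQuotientMap_mk {X : Set M1} (hX : ∀ (g : SO3), ∀ μ ∈ X, g • μ ∈ X) :
    IsOpenQuotientMap (Quotient.mk (rotationSetoid X)) := by
  refine ⟨Quotient.mk_surjective, continuous_quotient_mk', fun U hU => ?_⟩
  have h : Quotient.mk (rotationSetoid X) ⁻¹' (Quotient.mk (rotationSetoid X) '' U)
      = ⋃ g : SO3, (fun x : X => (⟨g • (x : M1), hX g x x.2⟩ : X)) ⁻¹' U := by
    ext x
    simp only [Set.mem_preimage, Set.mem_image, Set.mem_iUnion, mk_eq_mk_iff]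
    constructor
    · rintro ⟨y, hy, g, hg⟩
      exact ⟨g, by simpa only [hg] using hy⟩
    · rintro ⟨g, hg⟩
      exact ⟨_, hg, g, rfl⟩
  refine isQuotientMap_quotient_mk'.isOpen_preimage.1 (h ▸ ?_)
  exact isOpen_iUnion fun g => hU.preimage <|
    ((continuous_const_smul g).comp continuous_subtype_val).subtype_mk _

/-- For an open quotient map, Hausdorffness means that the relation is closed. The relation is the
projection of a closed set along the compact factor `SO3`. -/
theorem t2Space_modRotations {X : Set M1} (hX : ∀ (g : SO3), ∀ μ ∈ X, g • μ ∈ X) :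
    T2Space (ModRotations X) := by
  rw [t2Space_iff_of_isOpenQuotientMap (isOpenQuotientMap_mk hX)]
  have h : IsClosed {p : SO3 × (X × X) | p.1 • (p.2.2 : M1) = p.2.1} :=
    isClosed_eq (by fun_prop) (by fun_prop)
  convert isClosedMap_snd_of_compactSpace _ h using 1
  ext q
  simp [mk_eq_mk_iff]

theorem inclusionModRotations_mk {X Y : Set M1} (h : X ⊆ Y) (x : X) :
    inclusionModRotations h (Quotient.mk _ x) = Quotient.mk _ (Set.inclusion h x) := rfl

theorem isOpenEmbedding_inclusionModRotations {X Y : Set M1} (h : X ⊆ Y)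
    (hX : ∀ (g : SO3), ∀ μ ∈ X, g • μ ∈ X) (hY : ∀ (g : SO3), ∀ μ ∈ Y, g • μ ∈ Y)
    (hopen : IsOpen ((↑) ⁻¹' X : Set Y)) :
    IsOpenEmbedding (inclusionModRotations h) := by
  have hq := isOpenQuotientMap_mk hX
  refine IsOpenEmbedding.of_continuous_injective_isOpenMap ?_ ?_ ?_
  · exact hq.isQuotientMap.continuous_iff.2
      ((isOpenQuotientMap_mk hY).continuous.comp (continuous_inclusion h))
  · intro p q
    induction p using Quotient.inductionOn
    induction q using Quotient.inductionOn
    simp only [inclusionModRotations_mk, mk_eq_mk_iff]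
    exact id
  · intro U hU
    have hi : IsOpenMap (Set.inclusion h) :=
      (IsOpenEmbedding.inclusion h hopen).isOpenMap
    convert (isOpenQuotientMap_mk hY).isOpenMap _ (hi _ (hU.preimage hq.continuous)) using 1
    ext y
    constructor
    · rintro ⟨p, hp, rfl⟩
      induction p using Quotient.inductionOn with
      | h x => exact ⟨_, ⟨x, hp, rfl⟩, rfl⟩
    · rintro ⟨_, ⟨x, hx, rfl⟩, rfl⟩
      exact ⟨_, hx, rfl⟩

/-! ### Centered measures -/

/-- The probability measures with Euclidean center of mass at the origin. -/
def centered : Set M1 := {μ | ∫ x, (x : E3) ∂(μ : Measure S2) = 0}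

theorem integrable_of_continuous {F : Type*} [NormedAddCommGroup F] {f : S2 → F}
    (hf : Continuous f) (μ : M1) : Integrable f (μ : Measure S2) :=
  hf.integrable_of_hasCompactSupport (HasCompactSupport.of_compactSpace f)

theorem norm_coe_S2 (x : S2) : ‖(x : E3)‖ = 1 := mem_sphere_zero_iff_norm.1 x.2

theorem ne_neg_S2 (x : S2) : x ≠ -x := fun h => by
  have h2 : (2 : ℝ) • (x : E3) = 0 := by
    rw [two_smul]
    nth_rw 2 [h]
    exact add_neg_cancel (x : E3)
  simpa [norm_coe_S2, norm_smul] using congrArg norm h2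

theorem isClosed_centered : IsClosed centered := by
  -- Weak convergence concerns scalar test functions, so the vector equation is tested against every
  -- `v`.
  have h : centered = ⋂ v : E3, {μ : M1 | ∫ x : S2, inner ℝ v (x : E3) ∂(μ : Measure S2) = 0} := by
    ext μ
    simp only [centered, Set.mem_ofPred_eq, Set.mem_iInter]
    simp only [fun v : E3 => integral_inner (𝕜 := ℝ)
      (integrable_of_continuous continuous_subtype_val μ) v]
    exact ⟨fun h v => by rw [h, inner_zero_right], fun h => inner_self_eq_zero.1 (h _)⟩
  rw [h]
  refine isClosed_iInter fun v => isClosed_eq ?_ continuous_const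
  exact ProbabilityMeasure.continuous_integral_continuousMap
    (⟨fun x : S2 => inner ℝ v (x : E3), by fun_prop⟩ : C(S2, ℝ))

theorem smul_mem_centered (g : SO3) (μ : M1) (hμ : μ ∈ centered) : g • μ ∈ centered := by
  change ∫ x, (x : E3) ∂((g • μ : M1) : Measure S2) = 0
  rw [coe_rotation_measure, integral_map (continuous_rotation g).measurable.aemeasurable
    continuous_subtype_val.aestronglyMeasurable]
  have := (LinearMap.toContinuousLinearMap (Matrix.toEuclideanLin
    (g : Matrix (Fin 3) (Fin 3) ℝ))).integral_comp_comm
      (integrable_of_continuous continuous_subtype_val μ)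
  rw [show ∫ x : S2, (x : E3) ∂(μ : Measure S2) = 0 from hμ, map_zero] at this
  exact this

theorem moebiusToOrigin_zero (x : S2) : moebiusToOrigin 0 x = x := by
  simp [moebiusToOrigin]

theorem mem_BCM_iff {μ : M1} :
    μ ∈ BCM ↔ μ ∈ centered ∧ ∀ z : S2, (μ : Measure S2) {z} < 1 / 2 := by
  simp [BCM, IsConformalBarycenter, centered, moebiusToOrigin_zero, and_comm]

theorem BCM_subset_centered : BCM ⊆ centered := fun _ h => (mem_BCM_iff.1 h).1

theorem rotation_measure_singleton (g : SO3) (μ : M1) (z : S2) :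
    ((g • μ : M1) : Measure S2) {z} = (μ : Measure S2) {g⁻¹ • z} := by
  rw [coe_rotation_measure, Measure.map_apply (continuous_rotation g).measurable
    (measurableSet_singleton z)]
  congr 1
  ext x
  simp [eq_inv_smul_iff]

theorem smul_mem_BCM (g : SO3) (μ : M1) (hμ : μ ∈ BCM) : g • μ ∈ BCM := by
  rw [mem_BCM_iff] at hμ ⊢
  exact ⟨smul_mem_centered g μ hμ.1, fun z => by
    rw [rotation_measure_singleton]; exact hμ.2 _⟩

/-! ### Pairs of antipodal atoms -/

theorem coe_halfHalf (x y : S2) : ((halfHalf x y : M1) : Measure S2)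
    = (1 / 2 : ENNReal) • Measure.dirac x + (1 / 2 : ENNReal) • Measure.dirac y := rfl

theorem halfHalf_comm (x y : S2) : halfHalf x y = halfHalf y x :=
  Subtype.ext (add_comm _ _)

theorem smul_halfHalf (g : SO3) (x y : S2) :
    g • halfHalf x y = halfHalf (g • x) (g • y) := Subtype.ext <| by
  change ((g • halfHalf x y : M1) : Measure S2) = (halfHalf (g • x) (g • y) : M1)
  have hg := (continuous_rotation g).measurable
  rw [coe_rotation_measure, coe_halfHalf, coe_halfHalf, Measure.map_add _ _ hg,
    Measure.map_smul, Measure.map_smul, Measure.map_dirac' hg, Measure.map_dirac' hg]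

theorem integral_halfHalf {F : Type*} [NormedAddCommGroup F] [NormedSpace ℝ F] [CompleteSpace F]
    (f : S2 → F) (x y : S2) :
    ∫ u, f u ∂(halfHalf x y : Measure S2) = (1 / 2 : ℝ) • f x + (1 / 2 : ℝ) • f y := by
  rw [coe_halfHalf, integral_add_measure, integral_smul_measure, integral_smul_measure,
    integral_dirac, integral_dirac]
  · simp
  · exact (integrable_dirac (by simp)).smul_measure (by simp)
  · exact (integrable_dirac (by simp)).smul_measure (by simp)

theorem continuous_halfHalf : Continuous fun p : S2 × S2 => halfHalf p.1 p.2 := by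
  rw [ProbabilityMeasure.continuous_iff_forall_continuousMap_continuous_integral]
  intro f
  simp only [integral_halfHalf]
  fun_prop

theorem halfHalf_neg_mem_centered (z : S2) : halfHalf z (-z) ∈ centered := by
  change ∫ u, (u : E3) ∂(halfHalf z (-z) : Measure S2) = 0
  rw [integral_halfHalf]
  simp

theorem halfHalf_apply_left {x y : S2} (h : x ≠ y) :
    (halfHalf x y : Measure S2) {x} = 1 / 2 := by
  simp [coe_halfHalf, h.symm]

theorem halfHalf_apply_of_ne {x y w : S2} (hx : x ≠ w) (hy : y ≠ w) :
    (halfHalf x y : Measure S2) {w} = 0 := by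
  simp [coe_halfHalf, hx, hy]

theorem halfHalf_neg_notMem_BCM (z : S2) : halfHalf z (-z) ∉ BCM := fun h =>
  ((mem_BCM_iff.1 h).2 z).ne (halfHalf_apply_left (ne_neg_S2 z))

/-- A centered measure with an atom of mass at least `1/2` is a pair of equal antipodal atoms. -/
theorem eq_halfHalf_of_half_le {μ : M1} (hμ : μ ∈ centered) {z : S2}
    (hz : 1 / 2 ≤ (μ : Measure S2) {z}) : μ = halfHalf z (-z) := by
  have hone : ∫ x : S2, (1 + inner ℝ (z : E3) (x : E3)) ∂(μ : Measure S2) = 1 := by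
    rw [integral_add (integrable_const _) (integrable_of_continuous (by fun_prop) μ),
      integral_inner (integrable_of_continuous continuous_subtype_val μ),
      show ∫ x : S2, (x : E3) ∂(μ : Measure S2) = 0 from hμ]
    simp
  have hzr : 1 / 2 ≤ (μ : Measure S2).real {z} := by
    have := ENNReal.toReal_mono (measure_ne_top _ _) hz
    simpa [Measure.real] using this
  -- This function is nonnegative and vanishes exactly at `z`, where the indicator cancels 1 + 1,
  -- and at `-z`. Its integral is `1 - 2 μ{z} ≤ 0`, so `μ` lives on these two points and `μ{z}` is
  -- exactly 1/2.
  set f : S2 → ℝ := fun x =>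
    (1 + inner ℝ (z : E3) (x : E3)) - Set.indicator {z} (fun _ => (2 : ℝ)) x with hf
  have hind : Integrable (Set.indicator {z} fun _ : S2 => (2 : ℝ)) (μ : Measure S2) :=
    (integrable_const _).indicator (measurableSet_singleton z)
  have hcont : Integrable (fun x : S2 => 1 + inner ℝ (z : E3) (x : E3)) (μ : Measure S2) :=
    integrable_of_continuous (by fun_prop) μ
  have hle : ∀ x : S2, -1 ≤ inner ℝ (z : E3) (x : E3) := fun x => by
    have := abs_real_inner_le_norm (z : E3) (x : E3)
    rw [norm_coe_S2, norm_coe_S2, one_mul] at this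
    exact (abs_le.1 this).1
  have hnonneg : 0 ≤ f := fun x => by
    by_cases hx : x = z
    · simp [hf, hx]
      norm_num
    · have := hle x
      simp only [hf, Pi.zero_apply, Set.mem_singleton_iff, hx, not_false_eq_true,
        Set.indicator_of_notMem]
      linarith
  have hint : ∫ x, f x ∂(μ : Measure S2) = 1 - 2 * (μ : Measure S2).real {z} := by
    rw [integral_sub hcont hind, hone, integral_indicator_const _ (measurableSet_singleton z),
      smul_eq_mul, mul_comm]
  have hf0 : ∫ x, f x ∂(μ : Measure S2) = 0 :=
    le_antisymm (by rw [hint]; linarith) (integral_nonneg hnonneg)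
  have hmass : (μ : Measure S2).real {z} = 1 / 2 := by linarith
  have hmass' : (μ : Measure S2) {z} = 1 / 2 := by
    rw [← ENNReal.ofReal_toReal (measure_ne_top (μ : Measure S2) {z})]
    rw [Measure.real] at hmass
    rw [hmass, ENNReal.ofReal_div_of_pos two_pos]
    simp
  have hae : ∀ᵐ x ∂(μ : Measure S2), x ∈ ({z} ∪ {-z} : Set S2) := by
    filter_upwards [(integral_eq_zero_iff_of_nonneg hnonneg (hcont.sub hind)).1 hf0] with x hx
    by_cases hxz : x = z
    · exact Or.inl hxz
    · right
      have h1 : inner ℝ (z : E3) (x : E3) = -1 := by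
        simp only [hf, Pi.zero_apply, Set.mem_singleton_iff, hxz, not_false_eq_true,
          Set.indicator_of_notMem] at hx
        linarith
      rw [inner_eq_neg_one_iff_of_norm_eq_one (norm_coe_S2 z) (norm_coe_S2 x)] at h1
      exact Subtype.ext (by simp [h1])
  have hdisj : Disjoint ({z} : Set S2) {-z} := by simpa using ne_neg_S2 z
  have hmeas : (μ : Measure S2) = (μ : Measure S2) {z} • Measure.dirac z
      + (μ : Measure S2) {-z} • Measure.dirac (-z) := by
    rw [← Measure.restrict_singleton, ← Measure.restrict_singleton,
      ← Measure.restrict_union hdisj (measurableSet_singleton _), Measure.restrict_eq_self_of_ae_mem hae]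
  have hmass2 : (μ : Measure S2) {-z} = 1 / 2 := by
    have h := measure_union (μ := (μ : Measure S2)) hdisj (measurableSet_singleton _)
    rw [(prob_compl_eq_zero_iff ((measurableSet_singleton z).union (measurableSet_singleton _))).1
      hae, hmass'] at h
    have h2 : (1 / 2 : ENNReal) + 1 / 2 = 1 / 2 + (μ : Measure S2) {-z} := by
      rw [← h]; exact ENNReal.add_halves 1
    exact ((ENNReal.add_right_inj (by simp)).1 h2).symm
  refine Subtype.ext ?_
  change (μ : Measure S2) = (halfHalf z (-z) : Measure S2)
  rw [coe_halfHalf, hmeas, hmass', hmass2]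

theorem mem_centered_iff {μ : M1} :
    μ ∈ centered ↔ μ ∈ BCM ∨ ∃ z, μ = halfHalf z (-z) := by
  constructor
  · intro h
    by_cases hb : ∀ z : S2, (μ : Measure S2) {z} < 1 / 2
    · exact Or.inl (mem_BCM_iff.2 ⟨h, hb⟩)
    · push Not at hb
      obtain ⟨z, hz⟩ := hb
      exact Or.inr ⟨z, eq_halfHalf_of_half_le h hz⟩
  · rintro (h | ⟨z, rfl⟩)
    · exact BCM_subset_centered h
    · exact halfHalf_neg_mem_centered z

/-! ### The closure of the barycentered measures -/

/-- The convex combination `(1 - t) μ + t ν`. -/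
noncomputable def mix (μ ν : M1) (t : unitInterval) : M1 :=
  ⟨ENNReal.ofReal (1 - t) • (μ : Measure S2) + ENNReal.ofReal t • (ν : Measure S2), ⟨by
    simp [← ENNReal.ofReal_add (sub_nonneg.2 t.2.2) t.2.1]⟩⟩

theorem coe_mix (μ ν : M1) (t : unitInterval) : (mix μ ν t : Measure S2)
    = ENNReal.ofReal (1 - t) • (μ : Measure S2) + ENNReal.ofReal t • (ν : Measure S2) := rfl

theorem integral_mix {F : Type*} [NormedAddCommGroup F] [NormedSpace ℝ F] {f : S2 → F}
    (hf : Continuous f) (μ ν : M1) (t : unitInterval) :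
    ∫ x, f x ∂(mix μ ν t : Measure S2)
      = (1 - t : ℝ) • ∫ x, f x ∂(μ : Measure S2) + (t : ℝ) • ∫ x, f x ∂(ν : Measure S2) := by
  rw [coe_mix, integral_add_measure, integral_smul_measure, integral_smul_measure,
    ENNReal.toReal_ofReal (sub_nonneg.2 t.2.2), ENNReal.toReal_ofReal t.2.1]
  · exact (integrable_of_continuous hf μ).smul_measure ENNReal.ofReal_ne_top
  · exact (integrable_of_continuous hf ν).smul_measure ENNReal.ofReal_ne_top

theorem continuous_mix (μ ν : M1) : Continuous (mix μ ν) := by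
  rw [ProbabilityMeasure.continuous_iff_forall_continuousMap_continuous_integral]
  intro f
  simp only [integral_mix f.continuous]
  fun_prop

theorem mix_zero (μ ν : M1) : mix μ ν 0 = μ := Subtype.ext <| by
  change (mix μ ν 0 : Measure S2) = μ
  simp [coe_mix]

/-- Otherwise `z` would be plus or minus every coordinate vector at once. -/
theorem exists_S2_ne_ne (z : S2) : ∃ u : S2, u ≠ z ∧ -u ≠ z := by
  let e : Fin 3 → S2 := fun i => ⟨EuclideanSpace.single i 1, by simp⟩
  by_contra! h
  have key : ∀ i, (z : E3) i ≠ 0 := fun i => by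
    by_cases hi : e i = z
    · simp [← hi, e]
    · simp [← h (e i) hi, e]
  by_cases hi : e 0 = z
  · exact key 1 (by simp [← hi, e])
  · exact key 1 (by simp [← h _ hi, e])

/-- Mix in a second antipodal pair with weight `t` in (0, 1/2): the atoms at `z` and `-z` drop to
`(1 - t)/2`, every other point has mass at most `t`, and the center of mass stays at zero. Then let
`t` tend to 0. -/
theorem halfHalf_neg_mem_closure_BCM (z : S2) : halfHalf z (-z) ∈ closure BCM := by
  obtain ⟨u, hu, hu'⟩ := exists_S2_ne_ne z
  have hhalf : (0 : ℝ) ≤ 1 / 2 ∧ (1 / 2 : ℝ) ≤ 1 := by norm_num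
  have h0 : (0 : unitInterval) ∈ closure (Set.Ioo (0 : unitInterval) ⟨1 / 2, hhalf⟩) := by
    have hlt : (0 : unitInterval) < ⟨1 / 2, hhalf⟩ := by
      rw [← Subtype.coe_lt_coe]; norm_num
    rw [closure_Ioo hlt.ne]
    exact Set.left_mem_Icc.2 hlt.le
  rw [← mix_zero (halfHalf z (-z)) (halfHalf u (-u))]
  refine map_mem_closure (continuous_mix _ _) h0 fun t ht => ?_
  obtain ⟨ht0, ht1⟩ : (0 : ℝ) < t ∧ (t : ℝ) < 1 / 2 := ht
  have hhalf2 : (1 / 2 : ENNReal) = ENNReal.ofReal (1 / 2) := by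
    rw [ENNReal.ofReal_div_of_pos two_pos]; simp
  refine mem_BCM_iff.2 ⟨?_, fun w => ?_⟩
  · change ∫ x, (x : E3) ∂(mix _ _ t : Measure S2) = 0
    rw [integral_mix continuous_subtype_val,
      show ∫ x, (x : E3) ∂(halfHalf z (-z) : Measure S2) = 0 from halfHalf_neg_mem_centered z,
      show ∫ x, (x : E3) ∂(halfHalf u (-u) : Measure S2) = 0 from halfHalf_neg_mem_centered u]
    simp
  · rw [coe_mix, Measure.add_apply, Measure.smul_apply, Measure.smul_apply, smul_eq_mul,
      smul_eq_mul]
    by_cases hw : z = w ∨ -z = w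
    · have h1 : (halfHalf z (-z) : Measure S2) {w} = 1 / 2 := by
        rcases hw with rfl | rfl
        · exact halfHalf_apply_left (ne_neg_S2 z)
        · rw [halfHalf_comm]
          exact halfHalf_apply_left (ne_neg_S2 z).symm
      have h2 : (halfHalf u (-u) : Measure S2) {w} = 0 := by
        rcases hw with rfl | rfl
        · exact halfHalf_apply_of_ne hu hu'
        · exact halfHalf_apply_of_ne (fun h => hu' (by rw [h, neg_neg]))
            (fun h => hu (neg_injective h))
      rw [h1, h2, mul_zero, add_zero, hhalf2, ← ENNReal.ofReal_mul (by linarith),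
        ENNReal.ofReal_lt_ofReal_iff (by norm_num)]
      linarith
    · push Not at hw
      rw [halfHalf_apply_of_ne hw.1 hw.2, mul_zero, zero_add]
      refine (mul_le_of_le_one_right' prob_le_one).trans_lt ?_
      rw [hhalf2, ENNReal.ofReal_lt_ofReal_iff (by norm_num)]
      exact ht1

theorem closure_BCM : closure BCM = centered := by
  refine (isClosed_centered.closure_subset_iff.2 BCM_subset_centered).antisymm fun μ hμ => ?_
  rcases mem_centered_iff.1 hμ with h | ⟨z, rfl⟩
  · exact subset_closure h
  · exact halfHalf_neg_mem_closure_BCM z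

/-! ### Transitivity of the rotation action up to sign -/

/-- The half-turn `2 u uᵀ - 1` about the bisector `u = (x + y)/‖x + y‖` exchanges `x` and `y`; the
hypothesis is what makes the bisector exist. -/
theorem exists_rotation_eq {x y : S2} (h : (x : E3) + y ≠ 0) : ∃ g : SO3, g • x = y := by
  obtain ⟨x, hx⟩ := x
  obtain ⟨y, hy⟩ := y
  simp only at h
  have hx2 : x 0 ^ 2 + x 1 ^ 2 + x 2 ^ 2 = 1 := by
    have := EuclideanSpace.real_norm_sq_eq x
    rw [mem_sphere_zero_iff_norm.1 hx, Fin.sum_univ_three] at this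
    linarith
  have hy2 : y 0 ^ 2 + y 1 ^ 2 + y 2 ^ 2 = 1 := by
    have := EuclideanSpace.real_norm_sq_eq y
    rw [mem_sphere_zero_iff_norm.1 hy, Fin.sum_univ_three] at this
    linarith
  have hn : 0 < ‖x + y‖ := norm_pos_iff.2 h
  have hs : ‖x + y‖ ^ 2 = (x 0 + y 0) ^ 2 + (x 1 + y 1) ^ 2 + (x 2 + y 2) ^ 2 := by
    rw [EuclideanSpace.real_norm_sq_eq, Fin.sum_univ_three]
    simp
  set r := ‖x + y‖ with hr
  obtain ⟨u, hu⟩ : ∃ u : Fin 3 → ℝ, ∀ i, r * u i = x i + y i :=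
    ⟨fun i => (x i + y i) / r, fun i => by field_simp⟩
  have hu2 : u 0 ^ 2 + u 1 ^ 2 + u 2 ^ 2 = 1 := by
    have : r ^ 2 * (u 0 ^ 2 + u 1 ^ 2 + u 2 ^ 2) = r ^ 2 * 1 := by
      rw [mul_one]; nth_rw 2 [hs]; rw [← hu, ← hu, ← hu]; ring
    exact mul_left_cancel₀ (by positivity) this
  -- This is where `x` and `y` having equal length enters: `2⟨x + y, x⟩ = ‖x + y‖²`.
  have hux : 2 * (u 0 * x 0 + u 1 * x 1 + u 2 * x 2) = r := by
    have : r * (2 * (u 0 * x 0 + u 1 * x 1 + u 2 * x 2)) = r * r := by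
      have e : r * (2 * (u 0 * x 0 + u 1 * x 1 + u 2 * x 2))
          = 2 * ((r * u 0) * x 0 + (r * u 1) * x 1 + (r * u 2) * x 2) := by ring
      rw [e, hu, hu, hu, ← sq, hs]
      linear_combination hx2 - hy2
    exact mul_left_cancel₀ hn.ne' this
  let A : Matrix (Fin 3) (Fin 3) ℝ := (2 : ℝ) • Matrix.vecMulVec u u - 1
  have hA : A ∈ Matrix.specialOrthogonalGroup (Fin 3) ℝ := by
    rw [Matrix.mem_specialOrthogonalGroup_iff, Matrix.mem_orthogonalGroup_iff]
    have huu : u ⬝ᵥ u = 1 := by rw [← hu2]; simp [dotProduct, Fin.sum_univ_three]; ring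
    constructor
    · have ht : A.transpose = A := by
        simp [A, Matrix.transpose_vecMulVec]
      have hv : Matrix.vecMulVec u u * Matrix.vecMulVec u u = Matrix.vecMulVec u u := by
        rw [Matrix.vecMulVec_mul_vecMulVec, huu]; simp
      change A * A.transpose = 1
      rw [ht]
      simp only [A, sub_mul, mul_sub, smul_mul_assoc, mul_smul_comm, hv, one_mul, mul_one]
      module
    · rw [Matrix.det_fin_three]
      simp [A, Matrix.vecMulVec_apply]
      -- The determinant equals `2‖u‖² - 1`.
      linear_combination 2 * hu2
  refine ⟨⟨A, hA⟩, Subtype.ext ?_⟩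
  rw [coe_rotation]
  ext i
  have hc : (Matrix.toEuclideanLin A x : E3) i
      = 2 * (u 0 * x 0 + u 1 * x 1 + u 2 * x 2) * u i - x i := by
    have : (Matrix.toEuclideanLin A x : E3) i = (A.mulVec x.ofLp) i := rfl
    rw [this]
    simp [A, Matrix.sub_mulVec, Matrix.smul_mulVec, Matrix.vecMulVec_mulVec, dotProduct,
      Fin.sum_univ_three]
    ring
  change (Matrix.toEuclideanLin A x : E3) i = y i
  rw [hc, hux, hu]
  ring

theorem exists_smul_halfHalf_eq (x y : S2) :
    ∃ g : SO3, g • halfHalf x (-x) = halfHalf y (-y) := by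
  by_cases h : (x : E3) + y = 0
  · have : y = -x := Subtype.ext (eq_neg_of_add_eq_zero_right h)
    -- With `y = -x` there is no bisector, but the unordered pair is already the same.
    exact ⟨1, by rw [one_smul, this, neg_neg, halfHalf_comm]⟩
  · obtain ⟨g, rfl⟩ := exists_rotation_eq h
    exact ⟨g, by rw [smul_halfHalf, rotation_neg]⟩

/-! ### Stereographic projection -/

theorem stereo_infty : (stereo OnePoint.infty : E3) = !₂[0, 0, 1] := rfl

theorem stereo_coe (z : ℂ) : (stereo (z : OnePoint ℂ) : E3)
    = !₂[2 * z.re / (Complex.normSq z + 1), 2 * z.im / (Complex.normSq z + 1),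
        (Complex.normSq z - 1) / (Complex.normSq z + 1)] := rfl

theorem stereo_antipode (a : OnePoint ℂ) : stereo (antipode a) = -stereo a := by
  refine Subtype.ext ?_
  induction a with
  | infty =>
    change ((stereo ((0 : ℂ) : OnePoint ℂ) : S2) : E3) = -(stereo OnePoint.infty : E3)
    rw [stereo_coe, stereo_infty]
    ext i
    fin_cases i <;> simp
  | coe z =>
    by_cases hz : z = 0
    · have : antipode (z : OnePoint ℂ) = OnePoint.infty := if_pos hz
      change ((stereo (antipode (z : OnePoint ℂ)) : S2) : E3) = -(stereo (z : OnePoint ℂ) : E3)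
      rw [this, stereo_coe, stereo_infty, hz]
      ext i
      fin_cases i <;> simp
    · have : antipode (z : OnePoint ℂ) = ((-1 / (starRingEnd ℂ) z : ℂ) : OnePoint ℂ) := if_neg hz
      change ((stereo (antipode (z : OnePoint ℂ)) : S2) : E3) = -(stereo (z : OnePoint ℂ) : E3)
      have hn : 0 < Complex.normSq z := Complex.normSq_pos.2 hz
      have h1 : Complex.normSq (-1 / (starRingEnd ℂ) z) = 1 / Complex.normSq z := by simp
      have h2 : (-1 / (starRingEnd ℂ) z).re = -z.re / Complex.normSq z := by
        simp [neg_div]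
      have h3 : (-1 / (starRingEnd ℂ) z).im = -z.im / Complex.normSq z := by
        simp [neg_div]
      rw [this, stereo_coe, stereo_coe, h1, h2, h3]
      ext i
      fin_cases i <;> simp <;> field_simp <;> ring

theorem stereo_surjective : Function.Surjective stereo := by
  rintro ⟨x, hx⟩
  have hx2 : x 0 ^ 2 + x 1 ^ 2 + x 2 ^ 2 = 1 := by
    have := EuclideanSpace.real_norm_sq_eq x
    rw [mem_sphere_zero_iff_norm.1 hx, Fin.sum_univ_three] at this
    linarith
  by_cases h : x 2 = 1
  · refine ⟨OnePoint.infty, Subtype.ext ?_⟩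
    rw [stereo_infty]
    have h0 : x 0 = 0 := by nlinarith [sq_nonneg (x 0), sq_nonneg (x 1)]
    have h1 : x 1 = 0 := by nlinarith [sq_nonneg (x 0), sq_nonneg (x 1)]
    ext i
    fin_cases i <;> simp [h, h0, h1]
  · have hs : 1 - x 2 ≠ 0 := sub_ne_zero.2 (Ne.symm h)
    refine ⟨((⟨x 0 / (1 - x 2), x 1 / (1 - x 2)⟩ : ℂ) : OnePoint ℂ), Subtype.ext ?_⟩
    have hn : Complex.normSq ⟨x 0 / (1 - x 2), x 1 / (1 - x 2)⟩ + 1 = 2 / (1 - x 2) := by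
      rw [Complex.normSq_apply]
      field_simp
      linear_combination hx2
    rw [stereo_coe, show Complex.normSq ⟨x 0 / (1 - x 2), x 1 / (1 - x 2)⟩ - 1
      = 2 / (1 - x 2) - 2 by linarith, hn]
    ext i
    fin_cases i <;> simp <;> field_simp
    ring

theorem exists_halfHalf_stereo_iff {μ : M1} :
    (∃ a : OnePoint ℂ, μ = halfHalf (stereo a) (stereo (antipode a)))
      ↔ ∃ z, μ = halfHalf z (-z) := by
  simp only [stereo_antipode]
  exact ⟨fun ⟨a, h⟩ => ⟨_, h⟩, fun ⟨z, h⟩ => by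
    obtain ⟨a, rfl⟩ := stereo_surjective z
    exact ⟨a, h⟩⟩

/-- The antipodal pairs are a continuous image of the sphere, hence a compact and closed set, and
`BCM` is its complement within the closure. -/
theorem isOpen_preimage_BCM : IsOpen ((↑) ⁻¹' BCM : Set (closure BCM)) := by
  have hc : IsClosed (Set.range fun z : S2 => halfHalf z (-z)) :=
    (isCompact_range (continuous_halfHalf.comp (continuous_id.prodMk continuous_neg))).isClosed
  convert hc.isOpen_compl.preimage (continuous_subtype_val (p := (· ∈ closure BCM))) using 1
  ext ⟨μ, hμ⟩
  rw [closure_BCM, mem_centered_iff] at hμ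
  simp only [Set.mem_preimage, Set.mem_compl_iff, Set.mem_range, not_exists]
  constructor
  · rintro h z rfl
    exact halfHalf_neg_notMem_BCM z h
  · intro h
    exact hμ.resolve_right fun ⟨z, hz⟩ => h z hz.symm

theorem smul_mem_closure_BCM (g : SO3) (μ : M1) (hμ : μ ∈ closure BCM) : g • μ ∈ closure BCM := by
  rw [closure_BCM] at hμ ⊢
  exact smul_mem_centered g μ hμ

/-- The class of the pairs of equal antipodal atoms. -/
noncomputable def antipodalClass : ModRotations (closure BCM) :=
  Quotient.mk _ ⟨_, halfHalf_neg_mem_closure_BCM (stereo OnePoint.infty)⟩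

theorem mk_eq_antipodalClass_iff {μ : M1} (hμ : μ ∈ closure BCM) :
    Quotient.mk (rotationSetoid (closure BCM)) ⟨μ, hμ⟩ = antipodalClass
      ↔ ∃ z, μ = halfHalf z (-z) := by
  refine mk_eq_mk_iff.trans ⟨?_, ?_⟩
  · rintro ⟨g, hg⟩
    exact ⟨g • stereo OnePoint.infty, by rw [← rotation_neg, ← smul_halfHalf]; exact hg.symm⟩
  · rintro ⟨z, rfl⟩
    exact exists_smul_halfHalf_eq _ z

theorem range_inclusion_BCM :
    Set.range (inclusionModRotations (subset_closure (s := BCM))) = {antipodalClass}ᶜ := by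
  ext p
  induction p using Quotient.inductionOn with
  | h a =>
    obtain ⟨μ, hμ⟩ := a
    rw [Set.mem_compl_singleton_iff, Ne, mk_eq_antipodalClass_iff hμ]
    constructor
    · rintro ⟨q, hq⟩ ⟨z, rfl⟩
      induction q using Quotient.inductionOn with
      | h b =>
        obtain ⟨g, hg⟩ := mk_eq_mk_iff.1 hq.symm
        replace hg : g • (b : M1) = halfHalf z (-z) := hg
        exact halfHalf_neg_notMem_BCM z (hg ▸ smul_mem_BCM g b b.2)
    · intro h
      have hμ' : μ ∈ BCM := (mem_centered_iff.1 (closure_BCM ▸ hμ)).resolve_right h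
      exact ⟨Quotient.mk _ ⟨μ, hμ'⟩, rfl⟩

theorem isOpenEmbedding_inclusion_BCM :
    IsOpenEmbedding (inclusionModRotations (subset_closure (s := BCM))) :=
  isOpenEmbedding_inclusionModRotations _ smul_mem_BCM smul_mem_closure_BCM isOpen_preimage_BCM

instance : CompactSpace (closure BCM) := isCompact_iff_compactSpace.1 isClosed_closure.isCompact

instance : T2Space (ModRotations (closure BCM)) := t2Space_modRotations smul_mem_closure_BCM

/-- If the quotient were compact, its image in the larger quotient would be closed, so `BCM` would
be closed in its own closure and would contain the antipodal pairs. -/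
theorem noncompactSpace_modRotations_BCM : NoncompactSpace (ModRotations BCM) := by
  rw [← not_compactSpace_iff]
  intro _
  have hcl : IsClosed (Set.range (inclusionModRotations (subset_closure (s := BCM)))) :=
    (isCompact_range isOpenEmbedding_inclusion_BCM.continuous).isClosed
  have hpre := hcl.preimage (continuous_quotient_mk' (s := rotationSetoid (closure BCM)))
  obtain ⟨C, hC, hCeq⟩ := isClosed_induced_iff.1 hpre
  have hsub : BCM ⊆ C := fun μ hμ => by
    have : (⟨μ, subset_closure hμ⟩ : closure BCM) ∈ Subtype.val ⁻¹' C := by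
      rw [hCeq]
      exact ⟨Quotient.mk _ ⟨μ, hμ⟩, rfl⟩
    exact this
  have hmem := halfHalf_neg_mem_closure_BCM (stereo OnePoint.infty)
  have : (⟨_, hmem⟩ : closure BCM) ∈ Subtype.val ⁻¹' C := hC.closure_subset_iff.2 hsub hmem
  rw [hCeq, range_inclusion_BCM] at this
  exact this rfl

end BaryMeasures

open BaryMeasures
theorem mainTheorem9 :
    LocallyCompactSpace (ModRotations BCM) ∧
    T2Space (ModRotations BCM) ∧
    NoncompactSpace (ModRotations BCM) ∧
    ∃ h : OnePoint (ModRotations BCM) ≃ₜ ModRotations (closure BCM),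
      (∀ p : ModRotations BCM,
        h (p : OnePoint (ModRotations BCM)) = inclusionModRotations subset_closure p) ∧
      ∀ μ : M1,
        (∃ hμ : μ ∈ closure BCM,
          (Quotient.mk (rotationSetoid (closure BCM)) ⟨μ, hμ⟩ : ModRotations (closure BCM))
            = h OnePoint.infty) ↔
        ∃ a : OnePoint ℂ, μ = halfHalf (stereo a) (stereo (antipode a)) := by
  -- Local compactness is inherited from the compact Hausdorff quotient along the open embedding.
  refine ⟨isOpenEmbedding_inclusion_BCM.locallyCompactSpace,
    t2Space_modRotations smul_mem_BCM, noncompactSpace_modRotations_BCM,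
    OnePoint.equivOfIsEmbeddingOfRangeEq antipodalClass _
      isOpenEmbedding_inclusion_BCM.isEmbedding range_inclusion_BCM, fun p => rfl, fun μ => ?_⟩
  rw [exists_halfHalf_stereo_iff, OnePoint.equivOfIsEmbeddingOfRangeEq_apply_infty]
  constructor
  · rintro ⟨hμ, h⟩
    exact (mk_eq_antipodalClass_iff hμ).1 h
  · rintro ⟨z, rfl⟩
    exact ⟨halfHalf_neg_mem_closure_BCM z, (mk_eq_antipodalClass_iff _).2 ⟨z, rfl⟩⟩
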